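/- Let $g:\mathbb{R}^m\to\mathbb{R}\cup\{\pm\infty\}$ be a polyhedral function, that is, a proper function whose epigraph is a polyhedral convex set (the solution set of finitely many affine inequalities). Let $\partial g$ be its subdifferential in the sense of convex analysis, $\operatorname{gph}\partial g=\{(z,\lambda)\mid \lambda\in\partial g(z)\}$, and let $(\bar z,\bar\lambda)\in\operatorname{gph}\partial g$. For $(z,\lambda)\in\operatorname{gph}\partial g$ and $t>0$ put $$\Delta_t^2 g(z,\lambda)(w)=\frac{g(z+tw)-g(z)-t\langle\lambda,w\rangle}{\tfrac12 t^2},\qquad w\in\mathbb{R}^m.$$ Call $g$ *strictly twice epi-differentiable* at $z$ for $\lambda\in\partial g(z)$ if there is a function $h:\mathbb{R}^m\to\mathbb{R}\cup\{\pm\infty\}$ such that the functions $\Delta_t^2 g(z',\lambda')$ epi-converge to $h$ (i.e. their epigraphs converge to the epigraph of $h$ in the sense of Painlevé–Kuratowski) as $t\searrow 0$ and $(z',\lambda')\to(z,\lambda)$ with $(z',\lambda')\in\operatorname{gph}\partial g$ and $g(z')\to g(z)$. Then the following properties are equivalent: (a) there is a neighborhood $O$ of $(\bar z,\bar\lambda)$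 such that for every $(z,\lambda)\in O\cap\operatorname{gph}\partial g$, $g$ is strictly twice epi-differentiable at $z$ for $\lambda$; (b) $\bar\lambda\in\operatorname{ri}\partial g(\bar z)$, where $\operatorname{ri}$ denotes the relative interior. -/

import Mathlib

open Filter Topology

noncomputable section

namespace VarAnalysis

/-- A polyhedral convex set in a finite-dimensional real vector space: the solution set of
finitely many (non-strict) affine inequalities. -/
def IsPolyhedralSet {V : Type*} [AddCommGroup V] [Module ℝ V] (C : Set V) : Prop :=
  ∃ (n : ℕ) (a : Fin n → Module.Dual ℝ V) (b : Fin n → ℝ), C = {x | ∀ i, a i x ≤ b i}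

/-- The epigraph `{(x, α) ∈ V × ℝ | f x ≤ α}` of an extended-real-valued function. -/
def epi {V : Type*} (f : V → EReal) : Set (V × ℝ) :=
  {p | f p.1 ≤ (p.2 : EReal)}

/-- Properness: `f` never takes the value `-∞` and is not identically `+∞`. -/
def IsProper {V : Type*} (f : V → EReal) : Prop :=
  (∀ x, f x ≠ ⊥) ∧ ∃ x, f x ≠ ⊤

/-- A polyhedral function: a proper function whose epigraph is a polyhedral convex set. -/
def IsPolyhedralFun {V : Type*} [AddCommGroup V] [Module ℝ V] (f : V → EReal) : Prop :=
  IsProper f ∧ IsPolyhedralSet (epi f)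

/-- The subdifferential of convex analysis, at points where `f` is finite
(empty at other points). -/
def subdifferential {V : Type*} [NormedAddCommGroup V] [InnerProductSpace ℝ V]
    (f : V → EReal) (x : V) : Set V :=
  {v | f x ≠ ⊥ ∧ f x ≠ ⊤ ∧ ∀ y, f x + ((inner ℝ v (y - x) : ℝ) : EReal) ≤ f y}

/-- The graph of the subgradient mapping `∂f`. -/
def gphSubdiff {V : Type*} [NormedAddCommGroup V] [InnerProductSpace ℝ V]
    (f : V → EReal) : Set (V × V) :=
  {p | p.2 ∈ subdifferential f p.1}

/-- The Painlevé–Kuratowski outer limit of a family of sets `C p` as `p` tends to the limit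
described by the (countably generated) filter `l`: limits of points `y k ∈ C (p k)` along some
sequence `p k` converging along `l`. -/
def outerLimit {P X : Type*} [TopologicalSpace X] (C : P → Set X) (l : Filter P) : Set X :=
  {x | ∃ p : ℕ → P, Tendsto p atTop l ∧
    ∃ y : ℕ → X, (∀ k, y k ∈ C (p k)) ∧ Tendsto y atTop (𝓝 x)}

/-- The Painlevé–Kuratowski inner limit: for every sequence `p k` converging along `l`,
the point is a limit of points `y k ∈ C (p k)`. -/
def innerLimit {P X : Type*} [TopologicalSpace X] (C : P → Set X) (l : Filter P) : Set X :=
  {x | ∀ p : ℕ → P, Tendsto p atTop l →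
    ∃ y : ℕ → X, (∀ᶠ k in atTop, y k ∈ C (p k)) ∧ Tendsto y atTop (𝓝 x)}

/-- Painlevé–Kuratowski convergence of a family of sets to `D`. -/
def SetConverges {P X : Type*} [TopologicalSpace X] (C : P → Set X) (l : Filter P)
    (D : Set X) : Prop :=
  innerLimit C l = D ∧ outerLimit C l = D

/-- Epi-convergence of a family of functions: convergence of the epigraphs. -/
def EpiConverges {P V : Type*} [TopologicalSpace V] (F : P → V → EReal) (l : Filter P)
    (h : V → EReal) : Prop :=
  SetConverges (fun p => epi (F p)) l (epi h)

/-- The second-order difference quotient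
`Δ_t² f(x, v)(w) = (f(x + t w) - f(x) - t ⟨v, w⟩) / (t² / 2)`,
meaningful for `t > 0` and `f x` finite. -/
def secondDiffQuot {V : Type*} [NormedAddCommGroup V] [InnerProductSpace ℝ V]
    (f : V → EReal) (t : ℝ) (x v w : V) : EReal :=
  (f (x + t • w) - f x - ((t * inner ℝ v w : ℝ) : EReal)) / ((t ^ 2 / 2 : ℝ) : EReal)

/-- The passage to the limit `t ↘ 0`, `(x', v') → (x, v)` within `gph ∂f`, `f x' → f x`,
as a filter on triples `(t, (x', v'))`. -/
def strictFilter {V : Type*} [NormedAddCommGroup V] [InnerProductSpace ℝ V]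
    (f : V → EReal) (x v : V) : Filter (ℝ × (V × V)) :=
  𝓝[>] (0 : ℝ) ×ˢ
    (𝓝[gphSubdiff f] (x, v) ⊓ comap (fun q : V × V => f q.1) (𝓝 (f x)))

/-- Strict twice epi-differentiability of `f` at `x` for `v` (where `v ∈ ∂f(x)`): the functions
`Δ_t² f(x', v')` epi-converge to some function as `t ↘ 0`, `(x', v') → (x, v)` within `gph ∂f`
and `f x' → f x`. -/
def StrictlyTwiceEpiDiffAt {V : Type*} [NormedAddCommGroup V] [InnerProductSpace ℝ V]
    (f : V → EReal) (x v : V) : Prop :=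
  ∃ h : V → EReal,
    EpiConverges (fun (p : ℝ × (V × V)) (w : V) => secondDiffQuot f p.1 p.2.1 p.2.2 w)
      (strictFilter f x v) h

end VarAnalysis

end

namespace VarAnalysis

variable {E : Type*} [NormedAddCommGroup E] [InnerProductSpace ℝ E]

/-! If λ ∈ ri ∂g(z), then ∂g is locally constant along its graph. Polyhedrality gives ∂g(z') ⊆ ∂g(z)
for z' near z. A common subgradient in ri ∂g(z) makes z' - z orthogonal to ∂g(z) - λ, whence the
reverse inclusion. The quotients then epi-converge to the indicator of the critical cone {w | ⟨μ -
λ, w⟩ ≤ 0 for all μ ∈ ∂g(z)}, since a polyhedral g is affine along small critical steps. If λ ∉ ri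
∂g(z), a proper supporting hyperplane gives a critical w and μ ∈ ∂g(z) with ⟨μ - λ, w⟩ < 0. With (z,
λ) fixed, the quotients at w are eventually at most 0. With λ tilted by t(μ - λ), their limits near
w are at least -2⟨μ - λ, w⟩ > 0. So no epi-limit exists. -/

lemma mem_subdifferential_iff {g : E → EReal} {z μ : E} {γ : ℝ} (hγ : g z = γ) :
    μ ∈ subdifferential g z ↔ ∀ (y : E) (r : ℝ), g y ≤ r → γ + inner ℝ μ (y - z) ≤ r := by
  constructor
  · rintro ⟨-, -, h⟩ y r hr
    have := (h y).trans hr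
    rw [hγ] at this
    exact_mod_cast this
  · intro h
    refine ⟨by simp [hγ], by simp [hγ], fun y => ?_⟩
    rw [hγ]
    refine EReal.le_of_forall_lt_iff_le.1 fun r hr => ?_
    exact_mod_cast h y r hr.le

lemma exists_real_of_mem_subdifferential {g : E → EReal} {z μ : E}
    (h : μ ∈ subdifferential g z) : ∃ γ : ℝ, g z = γ :=
  ⟨(g z).toReal, (EReal.coe_toReal h.2.1 h.1).symm⟩

lemma convex_subdifferential (g : E → EReal) (z : E) : Convex ℝ (subdifferential g z) := by
  intro μ hμ ν hν a b ha hb hab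
  obtain ⟨γ, hγ⟩ := exists_real_of_mem_subdifferential hμ
  rw [mem_subdifferential_iff hγ] at *
  intro y r hr
  have h1 := mul_le_mul_of_nonneg_left (hμ y r hr) ha
  have h2 := mul_le_mul_of_nonneg_left (hν y r hr) hb
  rw [inner_add_left, real_inner_smul_left, real_inner_smul_left]
  obtain rfl : a = 1 - b := by linarith
  linarith

lemma secondDiffQuot_le_iff {g : E → EReal} {z l w : E} {γ t α : ℝ} (hγ : g z = γ) (ht : 0 < t) :
    secondDiffQuot g t z l w ≤ α ↔
      g (z + t • w) ≤ ((γ + t * inner ℝ l w + t ^ 2 / 2 * α : ℝ) : EReal) := by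
  have ht2 : (0 : ℝ) < t ^ 2 / 2 := by positivity
  rw [secondDiffQuot, EReal.div_le_iff_le_mul (by exact_mod_cast ht2) (EReal.coe_ne_top _), hγ]
  induction g (z + t • w) with
  | bot => simp
  | top => simp [← EReal.coe_mul, -EReal.coe_add]
  | coe x =>
    norm_cast
    constructor <;> intro h <;> linarith

/-- Local description of a polyhedral function by finitely many inequalities. -/
lemma IsPolyhedralFun.exists_repr {g : E → EReal} (hg : IsPolyhedralFun g) :
    ∃ (n : ℕ) (v : Fin n → Module.Dual ℝ E) (c b : Fin n → ℝ), (∀ i, 0 ≤ c i) ∧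
      ∀ (x : E) (r : ℝ), g x ≤ r ↔ ∀ i, v i x - c i * r ≤ b i := by
  obtain ⟨⟨hbot, x₀, hx₀⟩, n, a, b, hab⟩ := hg
  have key (x : E) (r : ℝ) :
      g x ≤ r ↔ ∀ i, a i (x, 0) - -a i (0, 1) * r ≤ b i := by
    have h : (x, r) ∈ epi g ↔ ∀ i, a i (x, r) ≤ b i := by rw [hab]; rfl
    have hsplit (i : Fin n) : a i (x, r) = a i (x, 0) - -a i (0, 1) * r := by
      have : ((x, r) : E × ℝ) = (x, 0) + r • (0, 1) := by simp
      rw [this, map_add, map_smul, smul_eq_mul]; ring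
    simp only [hsplit] at h
    exact h
  refine ⟨n, fun i => a i ∘ₗ LinearMap.inl ℝ E ℝ, fun i => -a i (0, 1), b, fun i => ?_, key⟩
  by_contra! hneg
  have hr₀ : g x₀ = ((g x₀).toReal : ℝ) := (EReal.coe_toReal hx₀ (hbot _)).symm
  set r₀ := (g x₀).toReal
  -- Epigraphs are closed upward, so a constraint bounding the height from above fails at a large
  -- height.
  obtain ⟨k, hk⟩ := exists_nat_gt ((b i - a i (x₀, 0) - a i (0, 1) * r₀) / a i (0, 1))
  have hpos : 0 < a i (0, 1) := by linarith
  rw [div_lt_iff₀ hpos] at hk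
  have := (key x₀ (r₀ + k)).1 (by rw [hr₀]; exact_mod_cast by simp) i
  linarith

/-! ### Local structure of polyhedral functions -/

section Polyhedral

variable [FiniteDimensional ℝ E] {g : E → EReal} (hg : IsPolyhedralFun g)
include hg

/-- Along small directions that are critical for `l`, a polyhedral function is below its
linearization. -/
lemma IsPolyhedralFun.eventually_le_of_critical {z l : E} {γ : ℝ} (hγ : g z = γ)
    (hl : l ∈ subdifferential g z) :
    ∀ᶠ u in 𝓝 (0 : E), (∀ μ ∈ subdifferential g z, inner ℝ (μ - l) u ≤ 0) →
      g (z + u) ≤ ((γ + inner ℝ l u : ℝ) : EReal) := by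
  obtain ⟨n, v, c, b, hc, hrep⟩ := hg.exists_repr
  have hz : ∀ i, v i z - c i * γ ≤ b i := (hrep z γ).1 hγ.le
  have hev : ∀ i, ∀ᶠ u in 𝓝 (0 : E), (∀ μ ∈ subdifferential g z, inner ℝ (μ - l) u ≤ 0) →
      v i (z + u) - c i * (γ + inner ℝ l u) ≤ b i := by
    intro i
    rcases (hz i).lt_or_eq with hlt | hact
    · have hv : Continuous (v i) := (v i).continuous_of_finiteDimensional
      have hcont : Continuous fun u : E => v i (z + u) - c i * (γ + inner ℝ l u) := by fun_prop
      have := hcont.continuousAt.eventually_lt (x₀ := (0 : E)) continuousAt_const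
        (by simpa using hlt)
      filter_upwards [this] with u hu _ using hu.le
    · refine Eventually.of_forall fun u hu => ?_
      set q : E := (InnerProductSpace.toDual ℝ E).symm (LinearMap.toContinuousLinearMap (v i))
      have hq (x : E) : inner ℝ q x = v i x := by
        simp [q, InnerProductSpace.toDual_symm_apply]
      rw [mem_subdifferential_iff hγ] at hl
      suffices v i u - c i * inner ℝ l u ≤ 0 by rw [map_add]; linarith
      -- An active constraint yields a subgradient against which to test criticality: `l + q` if it
      -- bounds the domain, the slope `q / c i` otherwise.
      rcases (hc i).eq_or_lt with h0 | hpos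
      · have hmem : l + q ∈ subdifferential g z := by
          rw [mem_subdifferential_iff hγ]
          intro y r hr
          have h1 := (hrep y r).1 hr i
          have h2 := hl y r hr
          rw [← h0] at h1 hact
          rw [inner_add_left, hq, map_sub]
          linarith
        have := hu _ hmem
        rw [add_sub_cancel_left, hq] at this
        rw [← h0]; linarith
      · have hmem : (c i)⁻¹ • q ∈ subdifferential g z := by
          rw [mem_subdifferential_iff hγ]
          intro y r hr
          have h1 := (hrep y r).1 hr i
          rw [real_inner_smul_left, hq, map_sub]
          have : (c i)⁻¹ * (v i y - v i z) ≤ r - γ := by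
            rw [inv_mul_le_iff₀ hpos]; linarith
          linarith
        have := hu _ hmem
        rw [inner_sub_left, real_inner_smul_left, hq, sub_nonpos, inv_mul_le_iff₀ hpos] at this
        linarith
  filter_upwards [eventually_all.2 hev] with u hu hcrit
  exact (hrep _ _).2 fun i => hu i hcrit

/-- Subgradients of a polyhedral function at nearby points are subgradients at the base point. -/
lemma IsPolyhedralFun.eventually_subdifferential_subset {z l : E}
    (hl : l ∈ subdifferential g z) :
    ∀ᶠ z' in 𝓝 z, subdifferential g z' ⊆ subdifferential g z := by
  obtain ⟨n, v, c, b, hc, hrep⟩ := hg.exists_repr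
  obtain ⟨γ, hγ⟩ := exists_real_of_mem_subdifferential hl
  have hv (i : Fin n) : Continuous (v i) := (v i).continuous_of_finiteDimensional
  have hz : ∀ i, v i z - c i * γ ≤ b i := (hrep z γ).1 hγ.le
  have hev : ∀ i, ∀ᶠ z' in 𝓝 z, v i z - c i * γ < b i →
      v i z' - c i * (γ + inner ℝ l (z' - z)) < b i := by
    intro i
    by_cases hlt : v i z - c i * γ < b i
    · have hcont : Continuous fun z' : E => v i z' - c i * (γ + inner ℝ l (z' - z)) := by
        have := hv i
        fun_prop
      have := hcont.continuousAt.eventually_lt (x₀ := z) continuousAt_const (by simpa using hlt)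
      filter_upwards [this] with z' hz' _ using hz'
    · exact Eventually.of_forall fun z' h => absurd h hlt
  filter_upwards [eventually_all.2 hev] with z' hp l' hl'
  obtain ⟨γ', hγ'⟩ := exists_real_of_mem_subdifferential hl'
  have hz' : ∀ i, v i z' - c i * γ' ≤ b i := (hrep z' γ').1 hγ'.le
  have hlow : γ + inner ℝ l (z' - z) ≤ γ' := (mem_subdifferential_iff hγ).1 hl z' γ' hγ'.le
  rw [mem_subdifferential_iff hγ'] at hl'
  -- Constraints active at (z', γ') are active at (z, γ), so the segment joining these points
  -- extends slightly past (z', γ') inside the epigraph.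
  have hsmall : ∃ ε : ℝ, 0 < ε ∧ ∀ i,
      v i (z' + ε • (z' - z)) - c i * (γ' + ε * (γ' - γ)) ≤ b i := by
    have hall : ∀ᶠ ε : ℝ in 𝓝[>] 0, ∀ i,
        v i (z' + ε • (z' - z)) - c i * (γ' + ε * (γ' - γ)) ≤ b i := by
      refine eventually_all.2 fun i => ?_
      simp only [map_add, map_smul, map_sub, smul_eq_mul]
      rcases (hz' i).lt_or_eq with hlt' | hact'
      · have hcont : Continuous fun ε : ℝ =>
            v i z' + ε * (v i z' - v i z) - c i * (γ' + ε * (γ' - γ)) := by fun_prop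
        have := hcont.continuousAt.eventually_lt (x₀ := (0 : ℝ)) continuousAt_const
          (by simpa using hlt')
        exact (this.filter_mono nhdsWithin_le_nhds).mono fun _ h => h.le
      · have hact : v i z - c i * γ = b i := by
          refine (hz i).eq_of_not_lt fun hlt => ?_
          have := mul_le_mul_of_nonneg_left hlow (hc i)
          linarith [hp i hlt]
        refine Eventually.of_forall fun ε => le_of_eq ?_
        linear_combination (1 + ε) * hact' - ε * hact
    obtain ⟨ε, h1, h2⟩ := (hall.and self_mem_nhdsWithin).exists
    exact ⟨ε, h2, h1⟩
  obtain ⟨ε, hε, hle⟩ := hsmall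
  have h1 := hl' _ _ ((hrep _ _).2 hle)
  rw [add_sub_cancel_left, real_inner_smul_right] at h1
  have h2 : inner ℝ l' (z' - z) ≤ γ' - γ := le_of_mul_le_mul_left (by linarith) hε
  rw [mem_subdifferential_iff hγ]
  intro y r hr
  have h3 := hl' y r hr
  have : y - z = (y - z') + (z' - z) := by abel
  rw [this, inner_add_right]
  linarith

end Polyhedral

/-! ### Relative interiors of convex sets and of subdifferentials -/

/-- A point of a convex set outside its relative interior admits a proper supporting
hyperplane. -/
lemma exists_proper_support_of_notMem_intrinsicInterior [FiniteDimensional ℝ E] {D : Set E}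
    (hD : Convex ℝ D) {l : E} (hl : l ∈ D) (hri : l ∉ intrinsicInterior ℝ D) :
    ∃ w : E, (∀ μ ∈ D, inner ℝ (μ - l) w ≤ 0) ∧ ∃ μ ∈ D, inner ℝ (μ - l) w < 0 := by
  have hlA : l ∈ affineSpan ℝ D := subset_affineSpan ℝ D hl
  have : Nonempty (affineSpan ℝ D) := ⟨⟨l, hlA⟩⟩
  let l' : affineSpan ℝ D := ⟨l, hlA⟩
  -- With `l` moved to the origin of the direction space, relative interior becomes interior.
  let φ := (AffineIsometryEquiv.vaddConst ℝ l').toHomeomorph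
  set S : Set (affineSpan ℝ D) := (↑) ⁻¹' D
  set T : Set (affineSpan ℝ D).direction := φ ⁻¹' S
  have memT (x : (affineSpan ℝ D).direction) : x ∈ T ↔ (x : E) + l ∈ D := Iff.rfl
  have hTconv : Convex ℝ T := by
    intro x hx y hy a b ha hb hab
    rw [memT] at *
    have := hD hx hy ha hb hab
    convert this using 1
    obtain rfl : a = 1 - b := by linarith
    push_cast
    module
  have hint : interior T = φ ⁻¹' interior S := (φ.preimage_interior S).symm
  have hTne : (interior T).Nonempty := by
    obtain ⟨-, x, hx, rfl⟩ := Set.Nonempty.intrinsicInterior hD ⟨l, hl⟩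
    refine ⟨φ.symm x, ?_⟩
    rw [hint]
    simpa using hx
  have h0 : (0 : (affineSpan ℝ D).direction) ∉ interior T := by
    rw [hint]
    intro h
    refine hri ⟨φ 0, h, ?_⟩
    simp [φ, l']
  obtain ⟨f, hf⟩ := geometric_hahn_banach_open_point hTconv.interior isOpen_interior h0
  have hfle : ∀ x ∈ T, f x ≤ 0 := by
    intro x hx
    have hx' : x ∈ closure (interior T) := by
      rw [hTconv.closure_interior_eq_closure_of_nonempty_interior hTne]
      exact subset_closure hx
    exact closure_minimal (fun y hy => by simpa using (hf y hy).le)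
      (isClosed_le f.continuous continuous_const) hx'
  set w := (InnerProductSpace.toDual ℝ (affineSpan ℝ D).direction).symm f
  have hw (x : (affineSpan ℝ D).direction) : inner ℝ (x : E) (w : E) = f x := by
    rw [← Submodule.coe_inner, real_inner_comm, InnerProductSpace.toDual_symm_apply]
  refine ⟨w, fun μ hμ => ?_, ?_⟩
  · let x : (affineSpan ℝ D).direction :=
      ⟨μ - l, AffineSubspace.vsub_mem_direction (subset_affineSpan ℝ D hμ) hlA⟩
    have := hw x
    rw [show inner ℝ (μ - l) (w : E) = f x from this]
    exact hfle x (by rw [memT]; simpa [x] using hμ)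
  · obtain ⟨x, hx⟩ := hTne
    refine ⟨x + l, (memT x).1 (interior_subset hx), ?_⟩
    rw [add_sub_cancel_right, hw]
    simpa using hf x hx

/-- The segment from `μ` to `l` can be prolonged past `l` inside `D`, where the inequality reverses
sign; hence negative ε below. -/
lemma inner_eq_zero_of_mem_intrinsicInterior {D : Set E} {l w : E}
    (hl : l ∈ intrinsicInterior ℝ D) (hw : ∀ μ ∈ D, inner ℝ (μ - l) w ≤ 0) :
    ∀ μ ∈ D, inner ℝ (μ - l) w = 0 := by
  intro μ hμ
  obtain ⟨l', hl', rfl⟩ := hl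
  have : Nonempty (affineSpan ℝ D) := ⟨l'⟩
  have hcont : Continuous fun ε : ℝ =>
      (AffineMap.lineMap l' ⟨μ, subset_affineSpan ℝ D hμ⟩ ε : affineSpan ℝ D) :=
    AffineMap.lineMap_continuous
  have hev : ∀ᶠ ε : ℝ in 𝓝[<] 0,
      (AffineMap.lineMap l' ⟨μ, subset_affineSpan ℝ D hμ⟩ ε : affineSpan ℝ D) ∈
        ((↑) ⁻¹' D : Set (affineSpan ℝ D)) := by
    refine (hcont.continuousAt (x := 0)).tendsto.mono_left nhdsWithin_le_nhds ?_
    simpa using mem_interior_iff_mem_nhds.1 hl'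
  obtain ⟨ε, h1, h2⟩ := (hev.and self_mem_nhdsWithin).exists
  have h3 := hw _ h1
  refine le_antisymm (hw μ hμ) ?_
  have : (((AffineMap.lineMap l' ⟨μ, subset_affineSpan ℝ D hμ⟩ ε : affineSpan ℝ D) : E) - l') =
      ε • (μ - l') := by
    simp [AffineMap.lineMap_apply]
  rw [this, real_inner_smul_left] at h3
  exact nonneg_of_mul_nonpos_right h3 h2

lemma eventually_mem_intrinsicInterior {D : Set E} {l : E} (hl : l ∈ intrinsicInterior ℝ D) :
    ∀ᶠ l' in 𝓝 l, l' ∈ D → l' ∈ intrinsicInterior ℝ D := by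
  obtain ⟨l₀, hl₀, rfl⟩ := hl
  have : interior ((↑) ⁻¹' D : Set (affineSpan ℝ D)) ∈ 𝓝 l₀ := isOpen_interior.mem_nhds hl₀
  rw [nhds_subtype, mem_comap] at this
  obtain ⟨t, ht, hsub⟩ := this
  filter_upwards [ht] with l' hl' hD
  exact ⟨⟨l', subset_affineSpan ℝ D hD⟩, hsub hl', rfl⟩

/-- If a relative interior point of `∂g(z)` is a subgradient at `z'`, then every element of
`∂g(z)` is a subgradient at `z'` with the same increment. -/
lemma subdifferential_of_mem_intrinsicInterior {g : E → EReal} {z z' l : E} {γ γ' : ℝ}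
    (hγ : g z = γ) (hγ' : g z' = γ') (hl : l ∈ intrinsicInterior ℝ (subdifferential g z))
    (hl' : l ∈ subdifferential g z') {μ : E} (hμ : μ ∈ subdifferential g z) :
    γ' = γ + inner ℝ μ (z' - z) ∧ μ ∈ subdifferential g z' := by
  have hlD := intrinsicInterior_subset hl
  have heq : γ' = γ + inner ℝ l (z' - z) := by
    have h1 := (mem_subdifferential_iff hγ).1 hlD z' γ' hγ'.le
    have h2 := (mem_subdifferential_iff hγ').1 hl' z γ hγ.le
    rw [← neg_sub, inner_neg_right] at h2
    linarith
  have hin : inner ℝ (μ - l) (z' - z) = 0 := by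
    refine inner_eq_zero_of_mem_intrinsicInterior hl (fun ν hν => ?_) μ hμ
    have h1 := (mem_subdifferential_iff hγ).1 hν z' γ' hγ'.le
    rw [inner_sub_left]
    linarith
  rw [inner_sub_left] at hin
  have heq' : γ' = γ + inner ℝ μ (z' - z) := by linarith
  refine ⟨heq', (mem_subdifferential_iff hγ').2 fun y r hr => ?_⟩
  have h3 := (mem_subdifferential_iff hγ).1 hμ y r hr
  have : y - z = (y - z') + (z' - z) := by abel
  rw [this, inner_add_right] at h3
  linarith

/-! ### Strict limits and the two implications -/

lemma tendsto_strictFilter {g : E → EReal} {z l : E} {p : ℕ → ℝ × E × E}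
    (hp : Tendsto p atTop (strictFilter g z l)) :
    Tendsto (fun k => (p k).1) atTop (𝓝 0) ∧ (∀ᶠ k in atTop, 0 < (p k).1) ∧
      Tendsto (fun k => (p k).2) atTop (𝓝 (z, l)) ∧
      ∀ᶠ k in atTop, (p k).2.2 ∈ subdifferential g (p k).2.1 := by
  have h1 : Tendsto (fun k => (p k).1) atTop (𝓝[>] 0) := tendsto_fst.comp hp
  have h2 : Tendsto (fun k => (p k).2) atTop (𝓝[gphSubdiff g] (z, l)) :=
    (tendsto_snd.comp hp).mono_right inf_le_left
  exact ⟨h1.mono_right nhdsWithin_le_nhds, h1.eventually self_mem_nhdsWithin,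
    h2.mono_right nhdsWithin_le_nhds, h2.eventually self_mem_nhdsWithin⟩

/-- A sequence in the strict filter with the base point `z` fixed. -/
lemma tendsto_strictFilter_of_base {g : E → EReal} {z l : E} {L : ℕ → E}
    (hL : Tendsto L atTop (𝓝 l)) (hmem : ∀ k, L k ∈ subdifferential g z) :
    Tendsto (fun k : ℕ => ((1 / ((k : ℝ) + 1), z, L k) : ℝ × E × E)) atTop
      (strictFilter g z l) := by
  refine Tendsto.prodMk ?_ (tendsto_inf.2 ⟨?_, tendsto_comap_iff.2 tendsto_const_nhds⟩)
  · exact tendsto_nhdsWithin_iff.2 ⟨tendsto_one_div_add_atTop_nhds_zero_nat,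
      Eventually.of_forall fun k => Set.mem_Ioi.2 Nat.one_div_pos_of_nat⟩
  · exact tendsto_nhdsWithin_iff.2 ⟨tendsto_const_nhds.prodMk_nhds hL, Eventually.of_forall hmem⟩

lemma innerLimit_subset_outerLimit {P X : Type*} [TopologicalSpace X] (C : P → Set X)
    {l : Filter P} {p : ℕ → P} (hp : Tendsto p atTop l) : innerLimit C l ⊆ outerLimit C l := by
  intro x hx
  obtain ⟨y, hy, hlim⟩ := hx p hp
  obtain ⟨N, hN⟩ := eventually_atTop.1 hy
  exact ⟨fun k => p (k + N), hp.comp (tendsto_add_atTop_nat N), fun k => y (k + N),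
    fun k => hN _ (Nat.le_add_left _ _), hlim.comp (tendsto_add_atTop_nat N)⟩

lemma strictlyTwiceEpiDiffAt_of_mem_intrinsicInterior [FiniteDimensional ℝ E] {g : E → EReal}
    (hg : IsPolyhedralFun g) {z l : E}
    (hl : l ∈ intrinsicInterior ℝ (subdifferential g z)) : StrictlyTwiceEpiDiffAt g z l := by
  classical
  set D := subdifferential g z
  have hlD : l ∈ D := intrinsicInterior_subset hl
  obtain ⟨γ, hγ⟩ := exists_real_of_mem_subdifferential hlD
  have hnear : ∀ᶠ p in 𝓝 (z, l), p.2 ∈ subdifferential g p.1 →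
      p.2 ∈ intrinsicInterior ℝ D := by
    filter_upwards [(hg.eventually_subdifferential_subset hlD).prod_nhds
      (eventually_mem_intrinsicInterior hl)] with p hp hmem
    exact hp.2 (hp.1 hmem)
  let h : E → EReal := fun w => if ∀ μ ∈ D, inner ℝ (μ - l) w ≤ 0 then 0 else ⊤
  have mem_epi_h (w : E) (α : ℝ) :
      (w, α) ∈ epi h ↔ (∀ μ ∈ D, inner ℝ (μ - l) w ≤ 0) ∧ 0 ≤ α := by
    by_cases hw : ∀ μ ∈ D, inner ℝ (μ - l) w ≤ 0
    · simp only [epi, h, Set.mem_ofPred_eq, if_pos hw]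
      exact ⟨fun h => ⟨hw, EReal.coe_nonneg.1 h⟩, fun h => EReal.coe_nonneg.2 h.2⟩
    · simp only [epi, h, Set.mem_ofPred_eq, if_neg hw]
      exact ⟨fun h => absurd h (not_le.2 (EReal.coe_lt_top _)), fun h => absurd h.1 hw⟩
  refine ⟨h, ?_⟩
  set C : ℝ × E × E → Set (E × ℝ) :=
    fun p => epi fun w => secondDiffQuot g p.1 p.2.1 p.2.2 w with hC
  have hinner_outer : innerLimit C (strictFilter g z l) ⊆ outerLimit C (strictFilter g z l) :=
    innerLimit_subset_outerLimit C (tendsto_strictFilter_of_base tendsto_const_nhds fun _ => hlD)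
  have houter : outerLimit C (strictFilter g z l) ⊆ epi h := by
    rintro ⟨w, α⟩ ⟨p, hp, y, hy, hlim⟩
    obtain ⟨ht, htpos, hzl, hgph⟩ := tendsto_strictFilter hp
    have hyw : Tendsto (fun k => (y k).1) atTop (𝓝 w) := hlim.fst_nhds
    have hyα : Tendsto (fun k => (y k).2) atTop (𝓝 α) := hlim.snd_nhds
    have hbound : ∀ᶠ k in atTop, 0 < (p k).1 ∧ 0 ≤ (y k).2 ∧
        ∀ μ ∈ D, inner ℝ (μ - (p k).2.2) (y k).1 ≤ (p k).1 / 2 * (y k).2 := by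
      filter_upwards [htpos, hgph, hzl.eventually hnear] with k hk hmem hri
      obtain ⟨γ', hγ'⟩ := exists_real_of_mem_subdifferential hmem
      have hle := (secondDiffQuot_le_iff hγ' hk).1 (hy k)
      have hμ : ∀ μ ∈ D, inner ℝ (μ - (p k).2.2) (y k).1 ≤ (p k).1 / 2 * (y k).2 := by
        intro μ hμ
        have h1 := (subdifferential_of_mem_intrinsicInterior hγ hγ' (hri hmem) hmem hμ).2
        have h2 := (mem_subdifferential_iff hγ').1 h1 _ _ hle
        rw [add_sub_cancel_left, real_inner_smul_right] at h2
        rw [inner_sub_left]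
        refine le_of_mul_le_mul_left ?_ hk
        linarith
      refine ⟨hk, ?_, hμ⟩
      -- Taking μ to be the current subgradient gives nonnegativity of the height.
      have h3 := hμ _ (intrinsicInterior_subset (hri hmem))
      rw [sub_self, inner_zero_left] at h3
      exact nonneg_of_mul_nonneg_right h3 (by positivity)
    refine (mem_epi_h w α).2 ⟨fun μ hμ => ?_, ge_of_tendsto hyα (hbound.mono fun k hk => hk.2.1)⟩
    refine le_of_tendsto_of_tendsto (b := atTop)
      ((tendsto_const_nhds.sub hzl.snd_nhds).inner hyw) ?_ (hbound.mono fun k hk => hk.2.2 μ hμ)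
    simpa using (ht.div_const 2).mul hyα
  have hinner : epi h ⊆ innerLimit C (strictFilter g z l) := by
    rintro ⟨w, α⟩ hwα p hp
    obtain ⟨hw, hα⟩ := (mem_epi_h w α).1 hwα
    obtain ⟨ht, htpos, hzl, hgph⟩ := tendsto_strictFilter hp
    -- The constant sequence recovers: z' - z is orthogonal to D - l, so the total step from z stays
    -- critical.
    refine ⟨fun _ => (w, α), ?_, tendsto_const_nhds⟩
    have hu : Tendsto (fun k => (p k).2.1 - z + (p k).1 • w) atTop (𝓝 0) := by
      simpa using (hzl.fst_nhds.sub_const z).add (ht.smul_const w)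
    filter_upwards [htpos, hgph, hzl.eventually hnear,
      hu.eventually (hg.eventually_le_of_critical hγ hlD)] with k hk hmem hri hcrit
    obtain ⟨γ', hγ'⟩ := exists_real_of_mem_subdifferential hmem
    have hincr := fun μ hμ =>
      (subdifferential_of_mem_intrinsicInterior hγ hγ' (hri hmem) hmem (μ := μ) hμ).1
    have h1 := hcrit fun μ hμ => by
      have h2 := hw μ hμ
      have h3 := hincr μ hμ
      have h4 := hincr l hlD
      rw [inner_add_right, real_inner_smul_right]
      have h5 : inner ℝ (μ - l) ((p k).2.1 - z) = 0 := by rw [inner_sub_left]; linarith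
      rw [h5, zero_add]
      exact mul_nonpos_of_nonneg_of_nonpos hk.le h2
    refine (secondDiffQuot_le_iff hγ' hk).2 ?_
    have hpt : z + ((p k).2.1 - z + (p k).1 • w) = (p k).2.1 + (p k).1 • w := by abel
    rw [hpt] at h1
    refine h1.trans (EReal.coe_le_coe_iff.2 ?_)
    have h6 := inner_eq_zero_of_mem_intrinsicInterior hl hw _ (intrinsicInterior_subset (hri hmem))
    have h7 := hincr l hlD
    rw [inner_sub_left] at h6
    rw [inner_add_right, real_inner_smul_right]
    have h8 : (p k).1 * inner ℝ (p k).2.2 w = (p k).1 * inner ℝ l w := by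
      rw [sub_eq_zero.1 h6]
    have : 0 ≤ (p k).1 ^ 2 / 2 * α := by positivity
    linarith
  exact ⟨(hinner_outer.trans houter).antisymm hinner,
    houter.antisymm (hinner.trans hinner_outer)⟩

lemma StrictlyTwiceEpiDiffAt.mem_intrinsicInterior [FiniteDimensional ℝ E] {g : E → EReal}
    (hg : IsPolyhedralFun g) {z l : E} (hl : l ∈ subdifferential g z)
    (hs : StrictlyTwiceEpiDiffAt g z l) : l ∈ intrinsicInterior ℝ (subdifferential g z) := by
  by_contra hri
  have hconv := convex_subdifferential g z
  obtain ⟨w, hw, μ, hμ, hμw⟩ := exists_proper_support_of_notMem_intrinsicInterior hconv hl hri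
  obtain ⟨γ, hγ⟩ := exists_real_of_mem_subdifferential hl
  obtain ⟨h, hin, hout⟩ := hs
  have htlim : Tendsto (fun k : ℕ => 1 / ((k : ℝ) + 1)) atTop (𝓝 0) :=
    tendsto_one_div_add_atTop_nhds_zero_nat
  have hmem : (w, (0 : ℝ)) ∈ epi h := by
    rw [← hout]
    have hu : Tendsto (fun k : ℕ => (1 / ((k : ℝ) + 1)) • w) atTop (𝓝 0) := by
      simpa using htlim.smul_const w
    obtain ⟨N, hN⟩ := eventually_atTop.1 (hu.eventually (hg.eventually_le_of_critical hγ hl))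
    refine ⟨fun k => (1 / (((k + N : ℕ) : ℝ) + 1), z, l),
      (tendsto_strictFilter_of_base (L := fun _ => l) tendsto_const_nhds fun _ => hl).comp
        (tendsto_add_atTop_nat N), fun _ => (w, 0), fun k => ?_, tendsto_const_nhds⟩
    have hk : (0 : ℝ) < 1 / (((k + N : ℕ) : ℝ) + 1) := Nat.one_div_pos_of_nat
    refine (secondDiffQuot_le_iff hγ hk).2 ?_
    have h1 := hN (k + N) (Nat.le_add_left _ _) fun μ hμ => by
      rw [real_inner_smul_right]
      exact mul_nonpos_of_nonneg_of_nonpos hk.le (hw μ hμ)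
    simpa [real_inner_smul_right] using h1
  rw [← hin] at hmem
  -- The tilt has the size of the step t, so it contributes at order t², which the quotient detects.
  let L : ℕ → E := fun k => l + (1 / ((k : ℝ) + 1)) • (μ - l)
  have hL : Tendsto L atTop (𝓝 l) := by
    simpa [L] using (htlim.smul_const (μ - l)).const_add l
  have hLmem (k : ℕ) : L k ∈ subdifferential g z := by
    refine hconv.add_smul_sub_mem hl hμ ⟨Nat.one_div_pos_of_nat.le, ?_⟩
    rw [div_le_one (by positivity)]
    linarith [k.cast_nonneg (α := ℝ)]
  obtain ⟨y, hy, hlim⟩ := hmem _ (tendsto_strictFilter_of_base hL hLmem)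
  have hbound : ∀ᶠ k in atTop, -inner ℝ (μ - l) (y k).1 ≤ (y k).2 / 2 := by
    filter_upwards [hy] with k hk
    have ht : (0 : ℝ) < 1 / ((k : ℝ) + 1) := Nat.one_div_pos_of_nat
    have h1 := (mem_subdifferential_iff hγ).1 hl _ _ ((secondDiffQuot_le_iff hγ ht).1 hk)
    generalize hteq : 1 / ((k : ℝ) + 1) = t at *
    simp only [L, hteq] at h1
    rw [add_sub_cancel_left, real_inner_smul_right, inner_add_left, real_inner_smul_left] at h1
    refine le_of_mul_le_mul_left ?_ (pow_pos ht 2)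
    linarith
  have hlim1 : Tendsto (fun k => -inner ℝ (μ - l) (y k).1) atTop (𝓝 (-inner ℝ (μ - l) w)) :=
    (tendsto_const_nhds.inner hlim.fst_nhds).neg
  have hlim2 : Tendsto (fun k => (y k).2 / 2) atTop (𝓝 (0 / 2)) := hlim.snd_nhds.div_const 2
  have := le_of_tendsto_of_tendsto hlim1 hlim2 hbound
  linarith

end VarAnalysis

theorem theorem4p3 (m : ℕ) (g : EuclideanSpace ℝ (Fin m) → EReal)
    (hg : VarAnalysis.IsPolyhedralFun g)
    (zbar lbar : EuclideanSpace ℝ (Fin m))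
    (hbar : (zbar, lbar) ∈ VarAnalysis.gphSubdiff g) :
    (∃ O ∈ nhds (zbar, lbar), ∀ z l : EuclideanSpace ℝ (Fin m),
        (z, l) ∈ O ∩ VarAnalysis.gphSubdiff g → VarAnalysis.StrictlyTwiceEpiDiffAt g z l) ↔
      lbar ∈ intrinsicInterior ℝ (VarAnalysis.subdifferential g zbar) := by
  constructor
  · rintro ⟨O, hO, hstrict⟩
    exact (hstrict zbar lbar ⟨mem_of_mem_nhds hO, hbar⟩).mem_intrinsicInterior hg hbar
  · intro hri
    have hlD : lbar ∈ VarAnalysis.subdifferential g zbar := hbar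
    obtain ⟨γ, hγ⟩ := VarAnalysis.exists_real_of_mem_subdifferential hlD
    refine ⟨_, (hg.eventually_subdifferential_subset hlD).prod_nhds
      (VarAnalysis.eventually_mem_intrinsicInterior hri), ?_⟩
    rintro z l ⟨⟨hsub, hint⟩, hl⟩
    have hl : l ∈ VarAnalysis.subdifferential g z := hl
    have hlri : l ∈ intrinsicInterior ℝ (VarAnalysis.subdifferential g zbar) := hint (hsub hl)
    obtain ⟨γ', hγ'⟩ := VarAnalysis.exists_real_of_mem_subdifferential hl
    have hDsub : VarAnalysis.subdifferential g zbar ⊆ VarAnalysis.subdifferential g z :=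
      fun μ hμ => (VarAnalysis.subdifferential_of_mem_intrinsicInterior hγ hγ' hlri hl hμ).2
    refine VarAnalysis.strictlyTwiceEpiDiffAt_of_mem_intrinsicInterior hg ?_
    rwa [hsub.antisymm hDsub]
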